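/- Let $\mathbb{F}$ be an arbitrary field, let $V$ be an infinite-dimensional vector space over $\mathbb{F}$ (of any infinite dimension), and let $u$ be an endomorphism of $V$, that is, an $\mathbb{F}$-linear map from $V$ to $V$. Then: 1. there are endomorphisms $a_1,a_2,a_3,a_4$ of $V$ with $a_k^2=0$ for every $k\in\{1,2,3,4\}$ and $u=a_1+a_2+a_3+a_4$; 2. there are endomorphisms $p_1,p_2,p_3,p_4$ of $V$ with $p_k^2=p_k$ for every $k\in\{1,2,3,4\}$ and $u=p_1+p_2+p_3+p_4$. -/

import Mathlib

/-!
Call `T` off-diagonal if its two diagonal blocks with respect to some idempotent `P` vanish. Then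
`T = T P + T (1 - P)` is a sum of two square-zero elements, and
`1 + T = (1 + T) P + (1 + T) (1 - P)` is a sum of two idempotents. So it is enough to write every
endomorphism as a difference `T - S` of off-diagonal ones: apply this to `u` for the first claim
and to `u - 2 = T - S`, that is `u = (1 + T) + (1 - S)`, for the second.

Suppose a basis `e` is indexed by a well-order with a strictly increasing `s` such that `i < s i`
and `u (e i)` only involves basis vectors below `e (s i)`. Let `S` send `e i` to `e (s i)`. Then
`T = u + S` sends `e i` to `e (s i)` plus lower terms, so it shifts along `s` another basis, which
is unitriangular over `e`. Colouring the orbits of `s` alternately shows that `S` and `T` are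
off-diagonal.

To find such a basis, cut an arbitrary one into a well-ordered family of countably infinite blocks
such that `u` maps each block into the span of that block and the earlier ones. On a block,
enumerated by `ℕ`, any sufficiently fast growing sequence serves as `s`.
-/

open Module Set Function Cardinal

section OffDiagonal

/-- An element of a ring whose two diagonal blocks in the Peirce decomposition of some idempotent
vanish, so that it exchanges the two summands. Such elements are the building blocks of both
decompositions; the idempotent is not part of the data. -/
def IsOffDiagonal {A : Type*} [Ring A] (T : A) : Prop :=
  ∃ P : A, IsIdempotentElem P ∧ P * T * P = 0 ∧ (1 - P) * T * (1 - P) = 0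

theorem sq_mul_eq_zero_of_mul_mul_eq_zero {A : Type*} [MonoidWithZero A] {P T : A}
    (h : P * T * P = 0) : (T * P) ^ 2 = 0 := by
  rw [sq, mul_assoc, ← mul_assoc P, h, mul_zero]

theorem isIdempotentElem_one_add_mul_of_mul_mul_eq_zero {A : Type*} [Semiring A] {P T : A}
    (hP : IsIdempotentElem P) (h : P * T * P = 0) : IsIdempotentElem ((1 + T) * P) := by
  have hPTP : P * ((1 + T) * P) = P := by
    rw [← mul_assoc, mul_add, mul_one, add_mul, h, hP.eq, add_zero]
  rw [IsIdempotentElem, mul_assoc, hPTP]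

namespace IsOffDiagonal

variable {A : Type*} [Ring A] {T : A}

theorem neg (hT : IsOffDiagonal T) : IsOffDiagonal (-T) := by
  obtain ⟨P, hP, h, h'⟩ := hT
  exact ⟨P, hP, by rw [mul_neg, neg_mul, h, neg_zero], by rw [mul_neg, neg_mul, h', neg_zero]⟩

theorem exists_eq_add_sq_eq_zero (hT : IsOffDiagonal T) :
    ∃ a b : A, a ^ 2 = 0 ∧ b ^ 2 = 0 ∧ T = a + b := by
  obtain ⟨P, -, h, h'⟩ := hT
  exact ⟨T * P, T * (1 - P), sq_mul_eq_zero_of_mul_mul_eq_zero h,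
    sq_mul_eq_zero_of_mul_mul_eq_zero h', by noncomm_ring⟩

theorem exists_one_add_eq_add_isIdempotentElem (hT : IsOffDiagonal T) :
    ∃ p q : A, IsIdempotentElem p ∧ IsIdempotentElem q ∧ 1 + T = p + q := by
  obtain ⟨P, hP, h, h'⟩ := hT
  exact ⟨(1 + T) * P, (1 + T) * (1 - P), isIdempotentElem_one_add_mul_of_mul_mul_eq_zero hP h,
    isIdempotentElem_one_add_mul_of_mul_mul_eq_zero hP.one_sub h', by noncomm_ring⟩

end IsOffDiagonal

end OffDiagonal

section Shift

variable {ι : Type*} [LT ι] [WellFoundedLT ι] {s : ι → ι}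

theorem exists_semiconj_eqOn_compl_range {α : Type*} (hs : Injective s) (hlt : ∀ i, i < s i)
    (g : α → α) (a : ι → α) : ∃ f : ι → α, Semiconj f s g ∧ EqOn f a (range s)ᶜ := by
  classical
  let step (i : ι) (f : ∀ j < i, α) : α :=
    if h : ∃ j, s j = i then g (f h.choose ((hlt _).trans_eq h.choose_spec)) else a i
  let f : ι → α := wellFounded_lt.fix step
  have hfix (i : ι) : f i = step i fun j _ => f j := wellFounded_lt.fix_eq step i
  refine ⟨f, fun i => ?_, fun i hi => ?_⟩
  · have h : ∃ j, s j = s i := ⟨i, rfl⟩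
    have hchoose : h.choose = i := hs h.choose_spec
    rw [hfix]
    exact (dif_pos h).trans (congrArg (fun j => g (f j)) hchoose)
  · rw [hfix]
    exact dif_neg hi

variable {R M : Type*} [Ring R] [AddCommGroup M] [Module R M]

theorem isOffDiagonal_of_semiconj (b : Basis ι R M) (hs : Injective s) (hlt : ∀ i, i < s i)
    {T : End R M} (hT : Semiconj b s T) : IsOffDiagonal T := by
  obtain ⟨c, hc, -⟩ := exists_semiconj_eqOn_compl_range hs hlt not fun _ => true
  let P : End R M := b.constr ℕ fun i => if c i then b i else 0
  have hP (i : ι) : P (b i) = if c i then b i else 0 := b.constr_basis ℕ _ i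
  have hTb (i : ι) : T (b i) = b (s i) := (hT i).symm
  refine ⟨P, b.ext fun i => ?_, b.ext fun i => ?_, b.ext fun i => ?_⟩ <;>
    cases h : c i <;> simp [hP, hTb, hc.eq, h]

end Shift

section LowerSpan

variable {ι R M : Type*} [Preorder ι] [Semiring R] [AddCommMonoid M] [Module R M]

/-- The step `i` of the flag of a basis with an arbitrary ordered index type
(`Module.Basis.flag` is the case of `Fin n`), with `i` itself excluded. A family `f` is
unitriangular over `e` when `f i - e i ∈ lowerSpan e i` for all `i`. -/
def lowerSpan (e : Basis ι R M) (i : ι) : Submodule R M :=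
  Submodule.span R (e '' Iio i)

variable {e : Basis ι R M}

theorem lowerSpan_le_iff {i : ι} {N : Submodule R M} : lowerSpan e i ≤ N ↔ ∀ j < i, e j ∈ N :=
  Submodule.span_le.trans forall_mem_image

theorem mem_lowerSpan_iff {i : ι} {x : M} :
    x ∈ lowerSpan e i ↔ ∀ j ∈ (e.repr x).support, j < i :=
  e.mem_span_image

theorem basis_mem_lowerSpan {i j : ι} (h : i < j) : e i ∈ lowerSpan e j :=
  lowerSpan_le_iff.1 le_rfl i h

theorem lowerSpan_mono : Monotone (lowerSpan e) := fun _ _ h =>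
  lowerSpan_le_iff.2 fun _ hk => basis_mem_lowerSpan (hk.trans_le h)

theorem repr_eq_zero_of_mem_lowerSpan {i j : ι} {x : M} (hx : x ∈ lowerSpan e i) (hij : i ≤ j) :
    e.repr x j = 0 := by
  by_contra h
  exact hij.not_gt (mem_lowerSpan_iff.1 hx j (Finsupp.mem_support_iff.2 h))

end LowerSpan

section Triangular

variable {ι R M : Type*} [Ring R] [AddCommGroup M] [Module R M]

section Preorder

variable [Preorder ι] {e : Basis ι R M}

theorem span_range_eq_top_of_sub_mem_lowerSpan [WellFoundedLT ι] {f : ι → M}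
    (hf : ∀ i, f i - e i ∈ lowerSpan e i) : Submodule.span R (range f) = ⊤ := by
  have hmem (i : ι) : e i ∈ Submodule.span R (range f) := by
    induction i using WellFoundedLT.induction with
    | ind i ih =>
      have hsub : f i - e i ∈ Submodule.span R (range f) := lowerSpan_le_iff.2 ih (hf i)
      exact (Submodule.sub_mem_iff_right _ (Submodule.subset_span (mem_range_self i))).1 hsub
  rw [eq_top_iff, ← e.span_eq, Submodule.span_le]
  exact range_subset_iff.2 hmem

theorem lowerSpan_le_comap_of_sub_mem_lowerSpan {s : ι → ι} (hs : StrictMono s) {w : End R M}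
    (hw : ∀ i, w (e i) - e (s i) ∈ lowerSpan e (s i)) (i : ι) :
    lowerSpan e i ≤ (lowerSpan e (s i)).comap w := by
  refine lowerSpan_le_iff.2 fun j hj => ?_
  have hsub : w (e j) - e (s j) ∈ lowerSpan e (s i) := lowerSpan_mono (hs hj).le (hw j)
  exact (Submodule.sub_mem_iff_left _ (basis_mem_lowerSpan (hs hj))).1 hsub

end Preorder

variable [LinearOrder ι] {e : Basis ι R M}

theorem linearIndependent_of_sub_mem_lowerSpan {f : ι → M}
    (hf : ∀ i, f i - e i ∈ lowerSpan e i) : LinearIndependent R f := by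
  rw [linearIndependent_iff]
  intro l hl
  by_contra hne
  have hsupp : l.support.Nonempty := Finsupp.support_nonempty_iff.2 hne
  let m := l.support.max' hsupp
  have hcoeff : ∀ i ∈ l.support, e.repr (f i) m = Finsupp.single i 1 m := fun i hi => by
    have := repr_eq_zero_of_mem_lowerSpan (hf i) (l.support.le_max' i hi)
    rwa [map_sub, Finsupp.sub_apply, e.repr_self, sub_eq_zero] at this
  have hlm : l m = 0 :=
    calc l m = l.sum fun i a => a * Finsupp.single i 1 m := by
          simp [Finsupp.single_apply]
      _ = l.sum fun i a => a * e.repr (f i) m :=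
          Finset.sum_congr rfl fun i hi => congrArg (l i * ·) (hcoeff i hi).symm
      _ = e.repr (Finsupp.linearCombination R f l) m := by
          simp [Finsupp.linearCombination_apply, Finsupp.sum]
      _ = 0 := by rw [hl, map_zero, Finsupp.zero_apply]
  exact Finsupp.mem_support_iff.1 (l.support.max'_mem hsupp) hlm

variable [WellFoundedLT ι] {s : ι → ι}

theorem exists_basis_semiconj_of_sub_mem_lowerSpan (hs : StrictMono s) (hlt : ∀ i, i < s i)
    {w : End R M} (hw : ∀ i, w (e i) - e (s i) ∈ lowerSpan e (s i)) :
    ∃ b : Basis ι R M, Semiconj b s w := by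
  obtain ⟨f, hfs, hfe⟩ := exists_semiconj_eqOn_compl_range hs.injective hlt w e
  have hf (i : ι) : f i - e i ∈ lowerSpan e i := by
    induction i using WellFoundedLT.induction with
    | ind i ih =>
      by_cases hi : i ∈ range s
      · obtain ⟨j, rfl⟩ := hi
        have hwj : w (f j - e j) ∈ lowerSpan e (s j) :=
          lowerSpan_le_comap_of_sub_mem_lowerSpan hs hw j (ih j (hlt j))
        simpa [hfs.eq] using add_mem hwj (hw j)
      · simp [hfe hi]
  refine ⟨.mk (linearIndependent_of_sub_mem_lowerSpan hf)
    (span_range_eq_top_of_sub_mem_lowerSpan hf).ge, ?_⟩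
  rwa [Basis.coe_mk]

theorem exists_eq_sub_isOffDiagonal_of_mem_lowerSpan (hs : StrictMono s) (hlt : ∀ i, i < s i)
    {u : End R M} (hu : ∀ i, u (e i) ∈ lowerSpan e (s i)) :
    ∃ T S : End R M, IsOffDiagonal T ∧ IsOffDiagonal S ∧ u = T - S := by
  let S : End R M := e.constr ℕ fun i => e (s i)
  have hS (i : ι) : S (e i) = e (s i) := e.constr_basis ℕ _ i
  obtain ⟨f, hf⟩ := exists_basis_semiconj_of_sub_mem_lowerSpan hs hlt (e := e) (w := u + S)
    fun i => by simpa [hS] using hu i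
  exact ⟨u + S, S, isOffDiagonal_of_semiconj f hs.injective hlt hf,
    isOffDiagonal_of_semiconj e hs.injective hlt fun i => (hS i).symm,
    (add_sub_cancel_right u S).symm⟩

end Triangular

section Blocks

theorem countable_setOf_reflTransGen {ι : Type*} {r : ι → ι → Prop}
    (hr : ∀ i, {j | r i j}.Countable) (i : ι) : {j | Relation.ReflTransGen r i j}.Countable := by
  let A (n : ℕ) : Set ι := (fun S => ⋃ k ∈ S, {j | r k j})^[n] {i}
  have hsucc (n : ℕ) : A (n + 1) = ⋃ k ∈ A n, {j | r k j} := iterate_succ_apply' _ _ _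
  have hA (n : ℕ) : (A n).Countable := by
    induction n with
    | zero => exact countable_singleton i
    | succ n ih => exact hsucc n ▸ ih.biUnion fun k _ => hr k
  refine (countable_iUnion hA).mono fun j hj => ?_
  induction hj with
  | refl => exact mem_iUnion.2 ⟨0, rfl⟩
  | tail _ hkj ih =>
    obtain ⟨n, hn⟩ := mem_iUnion.1 ih
    exact mem_iUnion.2 ⟨n + 1, hsucc n ▸ mem_biUnion hn hkj⟩

theorem exists_countable_closed_superset {ι : Type*} {r : ι → ι → Prop}
    (hr : ∀ i, {j | r i j}.Countable) {T : Set ι} (hT : T.Countable) :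
    ∃ K ⊇ T, K.Countable ∧ ∀ i j, r i j → i ∈ K → j ∈ K := by
  refine ⟨⋃ i ∈ T, {j | Relation.ReflTransGen r i j}, fun i hi => mem_biUnion hi .refl,
    hT.biUnion fun i _ => countable_setOf_reflTransGen hr i, fun i j hij hi => ?_⟩
  obtain ⟨k, hk, hki⟩ := mem_iUnion₂.1 hi
  exact mem_biUnion hk (hki.tail hij)

theorem exists_countable_closed_diff_infinite {ι : Type*} {r : ι → ι → Prop}
    (hr : ∀ i, {j | r i j}.Countable) (A : Set ι) (x : ι) :
    ∃ K : Set ι, x ∈ K ∧ K.Countable ∧ (∀ i j, r i j → i ∈ K → j ∈ K) ∧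
      (Aᶜ.Infinite → (K \ A).Infinite) := by
  obtain ⟨T, hTA, hT, hTinf⟩ :
      ∃ T ⊆ Aᶜ, T.Countable ∧ (Aᶜ.Infinite → T.Infinite) := by
    by_cases hA : Aᶜ.Infinite
    · obtain ⟨T, hTA, hT, hTinf⟩ := hA.exists_subset_countable_infinite
      exact ⟨T, hTA, hT, fun _ => hTinf⟩
    · exact ⟨∅, empty_subset _, countable_empty, fun h => absurd h hA⟩
  obtain ⟨K, hTK, hK, hclosed⟩ := exists_countable_closed_superset hr (hT.insert x)
  exact ⟨K, hTK (mem_insert x T), hK, hclosed,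
    fun hA => (hTinf hA).mono fun i hi => ⟨hTK (mem_insert_of_mem x hi), hTA hi⟩⟩

universe v

theorem infinite_compl_biUnion_of_countable {ι κ : Type v} [Uncountable ι] {s : Set κ}
    (hs : #s < #ι) {C : κ → Set ι} (hC : ∀ k, (C k).Countable) :
    (⋃ k ∈ s, C k)ᶜ.Infinite := by
  have hlt : #(⋃ k ∈ s, C k : Set ι) < #ι :=
    calc #(⋃ k ∈ s, C k : Set ι) ≤ #s * ⨆ k : s, #(C k.1) := mk_biUnion_le C s
      _ ≤ #s * ℵ₀ := by
          gcongr
          exact ciSup_le' fun k => (hC k.1).le_aleph0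
      _ < #ι := mul_lt_of_lt aleph0_lt_mk.le hs aleph0_lt_mk
  rw [← infinite_coe_iff, infinite_iff, mk_compl_of_infinite _ hlt]
  exact aleph0_lt_mk.le

theorem exists_rank_countable_infinite_fibers {ι : Type v} [Uncountable ι] {r : ι → ι → Prop}
    (hr : ∀ i, {j | r i j}.Countable) :
    ∃ (_ : LinearOrder ι) (_ : WellFoundedLT ι) (ρ : ι → ι), (∀ i j, r i j → ρ j ≤ ρ i) ∧
      ∀ x, (ρ ⁻¹' {x}).Countable ∧ (ρ ⁻¹' {x}).Infinite := by
  -- An initial order type guarantees that the blocks built before any stage leave infinitely many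
  -- indices for the next block.
  obtain ⟨_, _, hord⟩ := exists_ord_eq_type_lt ι
  choose K hmemK hK hclosed hinf using exists_countable_closed_diff_infinite hr
  let C : ι → Set ι := wellFounded_lt.fix fun x C => K (⋃ (y) (h : y < x), C y h) x
  have hC (x : ι) : C x = K (⋃ y ∈ Iio x, C y) x := wellFounded_lt.fix_eq _ x
  have hcount (x : ι) : (C x).Countable := hC x ▸ hK _ x
  have hne (i : ι) : {x | i ∈ C x}.Nonempty := ⟨i, by rw [mem_ofPred, hC]; exact hmemK _ i⟩
  let ρ (i : ι) : ι := wellFounded_lt.min {x | i ∈ C x} (hne i)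
  have hρ_mem (i : ι) : i ∈ C (ρ i) := wellFounded_lt.min_mem _ (hne i)
  have hρ_le {i x : ι} (h : i ∈ C x) : ρ i ≤ x :=
    not_lt.1 (wellFounded_lt.not_lt_min {x | i ∈ C x} h)
  refine ⟨_, ‹_›, ρ, fun i j hij => hρ_le ?_, fun x => ⟨?_, ?_⟩⟩
  · have hi := hρ_mem i
    rw [hC] at hi ⊢
    exact hclosed _ _ i j hij hi
  · exact (hcount x).mono fun i hi => hi ▸ hρ_mem i
  · have hnew : (C x \ ⋃ y ∈ Iio x, C y).Infinite := by
      rw [hC x]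
      exact hinf _ x (infinite_compl_biUnion_of_countable (mk_Iio_lt x hord) hcount)
    refine hnew.mono fun i hi => (hρ_le hi.1).antisymm (not_lt.1 fun h => hi.2 ?_)
    exact mem_biUnion (mem_Iio.2 h) (hρ_mem i)

theorem exists_equiv_prod_nat_of_countable_infinite_fibers {ι κ : Type*} {ρ : ι → κ}
    (hρ : ∀ k, (ρ ⁻¹' {k}).Countable ∧ (ρ ⁻¹' {k}).Infinite) :
    ∃ φ : ι ≃ κ × ℕ, ∀ i, (φ i).1 = ρ i := by
  have hfiber (k : κ) : Nonempty ({i // ρ i = k} ≃ ℕ) := by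
    have : Countable {i // ρ i = k} := (hρ k).1.to_subtype
    have : Infinite {i // ρ i = k} := (hρ k).2.to_subtype
    exact nonempty_equiv_of_countable
  exact ⟨((Equiv.sigmaFiberEquiv ρ).symm.trans
    (Equiv.sigmaCongrRight fun k => (hfiber k).some)).trans (Equiv.sigmaEquivProd κ ℕ),
    fun _ => rfl⟩

theorem exists_equiv_prod_nat_fst_le {ι : Type v} [Infinite ι] {r : ι → ι → Prop}
    (hr : ∀ i, {j | r i j}.Countable) :
    ∃ (κ : Type v) (_ : LinearOrder κ) (_ : WellFoundedLT κ) (φ : ι ≃ κ × ℕ),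
      ∀ i j, r i j → (φ j).1 ≤ (φ i).1 := by
  by_cases h : Countable ι
  · obtain ⟨φ⟩ : Nonempty (ι ≃ PUnit.{v + 1} × ℕ) := nonempty_equiv_of_countable
    exact ⟨PUnit, inferInstance, inferInstance, φ, fun _ _ _ => le_rfl⟩
  · have : Uncountable ι := not_countable_iff.1 h
    obtain ⟨_, _, ρ, hmono, hfib⟩ := exists_rank_countable_infinite_fibers hr
    obtain ⟨φ, hφ⟩ := exists_equiv_prod_nat_of_countable_infinite_fibers hfib
    exact ⟨ι, _, ‹_›, φ, fun i j hij => by simpa only [hφ] using hmono i j hij⟩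

end Blocks

section FreeModule

universe v

variable {R M : Type*} [Ring R] [AddCommGroup M] [Module R M]

theorem exists_strictMono_lt_mem_lowerSpan {κ : Type*} [LinearOrder κ]
    (e : Basis (κ ×ₗ ℕ) R M) (u : End R M)
    (hu : ∀ i, ∀ j ∈ (e.repr (u (e i))).support, (ofLex j).1 ≤ (ofLex i).1) :
    ∃ s : κ ×ₗ ℕ → κ ×ₗ ℕ, StrictMono s ∧ (∀ i, i < s i) ∧ ∀ i, u (e i) ∈ lowerSpan e (s i) := by
  let t (k : κ) (n : ℕ) : ℕ := (e.repr (u (e (toLex (k, n))))).support.sup fun j => (ofLex j).2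
  choose s hs hs_gt using fun k => Filter.extraction_forall_of_eventually fun n =>
    (Filter.eventually_gt_atTop n).and (Filter.eventually_gt_atTop (t k n))
  refine ⟨fun i => toLex ((ofLex i).1, s (ofLex i).1 (ofLex i).2), fun i j hij => ?_,
    fun i => Prod.Lex.lt_iff.2 (Or.inr ⟨rfl, (hs_gt _ _).1⟩),
    fun i => mem_lowerSpan_iff.2 fun j hj => Prod.Lex.lt_iff.2 ?_⟩
  · rcases Prod.Lex.lt_iff.1 hij with hlt | ⟨heq, hlt⟩
    · exact Prod.Lex.lt_iff.2 (Or.inl hlt)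
    · exact Prod.Lex.lt_iff.2 (Or.inr ⟨heq, by simpa [heq] using hs (ofLex j).1 hlt⟩)
  · have ht : (ofLex j).2 ≤ t (ofLex i).1 (ofLex i).2 :=
      Finset.le_sup (f := fun j : κ ×ₗ ℕ => (ofLex j).2) hj
    exact (hu i j hj).lt_or_eq.imp_right fun heq => ⟨heq, ht.trans_lt (hs_gt _ _).2⟩

theorem exists_basis_lex_nat {ι : Type v} [Infinite ι] (b : Basis ι R M) (u : End R M) :
    ∃ (κ : Type v) (_ : LinearOrder κ) (_ : WellFoundedLT κ) (e : Basis (κ ×ₗ ℕ) R M),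
      ∀ i, ∀ j ∈ (e.repr (u (e i))).support, (ofLex j).1 ≤ (ofLex i).1 := by
  obtain ⟨κ, _, _, φ, hφ⟩ := exists_equiv_prod_nat_fst_le
    (r := fun i j => j ∈ (b.repr (u (b i))).support) fun i => Finset.countable_toSet _
  refine ⟨κ, _, ‹_›, b.reindex (φ.trans toLex), fun i j hj => ?_⟩
  simpa using hφ (φ.symm (ofLex i)) (φ.symm (ofLex j)) (by
    simpa [-Basis.repr_reindex, Basis.repr_reindex_apply] using hj)

theorem exists_eq_sub_isOffDiagonal {ι : Type*} [Infinite ι] (b : Basis ι R M) (u : End R M) :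
    ∃ T S : End R M, IsOffDiagonal T ∧ IsOffDiagonal S ∧ u = T - S := by
  obtain ⟨κ, _, _, e, he⟩ := exists_basis_lex_nat b u
  obtain ⟨s, hs, hlt, hu⟩ := exists_strictMono_lt_mem_lowerSpan e u he
  exact exists_eq_sub_isOffDiagonal_of_mem_lowerSpan hs hlt hu

theorem corollary1_general [Module.Free R M] (hM : ¬ Module.Finite R M) (u : End R M) :
    (∃ a : Fin 4 → End R M, (∀ k, a k ^ 2 = 0) ∧ u = ∑ k, a k) ∧
    (∃ p : Fin 4 → End R M, (∀ k, IsIdempotentElem (p k)) ∧ u = ∑ k, p k) := by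
  let b := Free.chooseBasis R M
  have : Infinite (Free.ChooseBasisIndex R M) :=
    not_finite_iff_infinite.1 fun _ => hM (.of_basis b)
  constructor
  · obtain ⟨T, S, hT, hS, hu⟩ := exists_eq_sub_isOffDiagonal b u
    obtain ⟨a₁, a₂, ha₁, ha₂, hTa⟩ := hT.exists_eq_add_sq_eq_zero
    obtain ⟨a₃, a₄, ha₃, ha₄, hSa⟩ := hS.neg.exists_eq_add_sq_eq_zero
    refine ⟨![a₁, a₂, a₃, a₄], by simp [Fin.forall_fin_succ, *], ?_⟩
    calc u = T + -S := by rw [hu, sub_eq_add_neg]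
      _ = ∑ k, ![a₁, a₂, a₃, a₄] k := by simp [hTa, hSa, Fin.sum_univ_four, add_assoc]
  · obtain ⟨T, S, hT, hS, hu⟩ := exists_eq_sub_isOffDiagonal b (u - 2)
    obtain ⟨p₁, p₂, hp₁, hp₂, hTp⟩ := hT.exists_one_add_eq_add_isIdempotentElem
    obtain ⟨p₃, p₄, hp₃, hp₄, hSp⟩ := hS.neg.exists_one_add_eq_add_isIdempotentElem
    refine ⟨![p₁, p₂, p₃, p₄], by simp [Fin.forall_fin_succ, *], ?_⟩
    calc u = (1 + T) + (1 + -S) := by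
          rw [eq_add_of_sub_eq hu, ← one_add_one_eq_two]
          abel
      _ = ∑ k, ![p₁, p₂, p₃, p₄] k := by simp [hTp, hSp, Fin.sum_univ_four, add_assoc]

end FreeModule

theorem corollary1 {F : Type*} [Field F] {V : Type*} [AddCommGroup V] [Module F V]
    (hV : ¬ FiniteDimensional F V) (u : Module.End F V) :
    (∃ a : Fin 4 → Module.End F V, (∀ k, a k ^ 2 = 0) ∧ u = ∑ k, a k) ∧
    (∃ p : Fin 4 → Module.End F V, (∀ k, IsIdempotentElem (p k)) ∧ u = ∑ k, p k) :=
  corollary1_general hV u
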